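/- Let $\ell$ and $m$ be integers with $2 \le \ell < m$, and let $G$ be a torsion-free abelian group, written multiplicatively. For a sequence $\mathcal{A} = (A_1, \ldots, A_m)$ of finite subsets of $G$, put $A = A_1 \cup \cdots \cup A_m$, let $$\Pi^{\ell}(\mathcal{A}) = \{a_{i_1} \cdots a_{i_\ell} : a_{i_j} \in A_{i_j},\ i_j \in \{1, \ldots, m\} \text{ for } 1 \le j \le \ell,\ i_r \ne i_s \text{ if } r \ne s\},$$ and for $a \in A$ let $$\mu_{\mathcal{A}}(a) = \min\bigl(\ell,\ |\{j \in \{1, \ldots, m\} : a \in A_j\}|\bigr).$$ Then there is no sequence $\mathcal{A} = (A_1, \ldots, A_m)$ of finite subsets of $G$ such that $|A_i| \ge 2$ for every $i \in \{1, \ldots, m\}$, $|\{a \in A : \mu_{\mathcal{A}}(a) \ge 2\}| \le 1$, and $$|\Pi^{\ell}(\mathcal{A})| = \sum_{a \in A} \mu_{\mathcal{A}}(a) - \ell + 1.$$ -/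

import Mathlib

/-- The generalized product set of a finite sequence `A` of finite subsets of a group: all products
`a₁ ⋯ a_ℓ`, in this order, of `ℓ` elements taken from `ℓ` distinct members of the sequence, the
members being chosen in any order (distinct members means distinct indices). -/
def genProductSet {G : Type*} [Group G] {m : ℕ} (ℓ : ℕ) (A : Fin m → Finset G) : Set G :=
  {x | ∃ i : Fin ℓ → Fin m, Function.Injective i ∧
    ∃ a : Fin ℓ → G, (∀ j, a j ∈ A (i j)) ∧ x = (List.ofFn a).prod}

/-- The generalized product set is finite, so its `Set.ncard` is its true cardinality. -/
theorem genProductSet_finite {G : Type*} [Group G] {m : ℕ} (ℓ : ℕ) (A : Fin m → Finset G) :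
    (genProductSet ℓ A).Finite := by
  refine (Set.finite_iUnion fun i : Fin ℓ → Fin m =>
    (Set.Finite.pi' fun j => (A (i j)).finite_toSet).image
      fun a : Fin ℓ → G => (List.ofFn a).prod).subset ?_
  rintro x ⟨i, -, a, ha, rfl⟩
  exact Set.mem_iUnion.2 ⟨i, a, ha, rfl⟩

/-- The union `A₁ ∪ ⋯ ∪ A_m` of the members of the sequence. -/
def seqUnion {G : Type*} [DecidableEq G] {m : ℕ} (A : Fin m → Finset G) : Finset G :=
  Finset.univ.biUnion A

/-- The truncated multiplicity `μ(a) = min(ℓ, ∑ⱼ χ_{Aⱼ}(a))`. -/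
def truncMult {G : Type*} [DecidableEq G] {m : ℕ} (ℓ : ℕ) (A : Fin m → Finset G) (a : G) : ℕ :=
  min ℓ (∑ j : Fin m, if a ∈ A j then 1 else 0)

/-! Embed the group in a linearly ordered one and translate the only element that can be repeated to
0; products become sums and the members are disjoint outside 0. Stripping off the largest element M,
positive after a possible sign change, lowers `weight` by one and loses at least one sum, whence the
bound `weight_add_one_le` by induction.

For the strict bound `weight_add_two_le`, one more sum must be lost somewhere. If the member `A i`
containing M has another nonzero element, stripping M preserves the hypotheses and induction
applies. Otherwise `A i ⊆ {0, M}`, and `IsTop.gain_two` shows that two sums are lost unless one of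
two rigid shapes, `OthersNonpos` or `ZeroUsed`, occurs. Either shape forces a negative element, so
the same analysis applies to `-A`; a shape for `A` is incompatible with a shape for `-A`. -/

namespace Transversal

set_option linter.unusedSectionVars false

open Finset
open scoped Pointwise

/-! ### Selections, weights and removal of one element. -/

section Basic

variable {ι Γ : Type*} [AddCommGroup Γ] [DecidableEq ι] {ℓ : ℕ} {A : ι → Finset Γ}
  {J : Finset ι} {a : ι → Γ}

/-- `a` selects one element from each of the `ℓ` members of `A` with index in `J`. -/
def IsSelection (ℓ : ℕ) (A : ι → Finset Γ) (J : Finset ι) (a : ι → Γ) : Prop :=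
  #J = ℓ ∧ ∀ j ∈ J, a j ∈ A j

theorem IsSelection.mono {B : ι → Finset Γ} (h : IsSelection ℓ A J a) (hAB : ∀ j, A j ⊆ B j) :
    IsSelection ℓ B J a :=
  ⟨h.1, fun j hj => hAB j (h.2 j hj)⟩

theorem IsSelection.update (h : IsSelection ℓ A J a) {i : ι} (hi : i ∈ J) {b : Γ}
    (hb : b ∈ A i) :
    IsSelection ℓ A J (Function.update a i b) ∧
      ∑ j ∈ J, Function.update a i b j = ∑ j ∈ J, a j - a i + b := by
  refine ⟨⟨h.1, fun j hj => ?_⟩, ?_⟩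
  · by_cases hji : j = i
    · subst hji; simpa using hb
    · simpa [Function.update_of_ne hji] using h.2 j hj
  · rw [sum_update_of_mem hi, ← add_sum_erase J a hi, sdiff_singleton_eq_erase]
    abel

theorem IsSelection.exchange (h : IsSelection ℓ A J a) {i j : ι} (hi : i ∉ J) (hj : j ∈ J)
    {b : Γ} (hb : b ∈ A i) :
    IsSelection ℓ A (insert i (J.erase j)) (Function.update a i b) ∧
      ∑ k ∈ insert i (J.erase j), Function.update a i b k = ∑ k ∈ J, a k - a j + b := by
  have hi' : i ∉ J.erase j := fun hh => hi (mem_of_mem_erase hh)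
  refine ⟨⟨?_, fun k hk => ?_⟩, ?_⟩
  · rw [card_insert_of_notMem hi', card_erase_of_mem hj, h.1]
    have := card_pos.2 ⟨j, hj⟩
    have := h.1
    omega
  · by_cases hki : k = i
    · subst hki; simpa using hb
    · have := mem_of_mem_erase ((mem_insert.1 hk).resolve_left hki)
      simpa [Function.update_of_ne hki] using h.2 k this
  · rw [sum_insert hi', sum_update_of_notMem hi', ← add_sum_erase J a hj]
    simp only [Function.update_self]
    abel

variable [Fintype ι] [DecidableEq Γ]

/-- All sums of `ℓ` elements selected from members of `A` with distinct indices. -/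
def selectionSums (ℓ : ℕ) (A : ι → Finset Γ) : Finset Γ :=
  (powersetCard ℓ univ).biUnion fun J =>
    (Fintype.piFinset fun i => if i ∈ J then A i else {0}).image fun a => ∑ i ∈ J, a i

theorem mem_selectionSums {x : Γ} :
    x ∈ selectionSums ℓ A ↔ ∃ J a, IsSelection ℓ A J a ∧ ∑ j ∈ J, a j = x := by
  simp only [selectionSums, mem_biUnion, mem_powersetCard, subset_univ, true_and, mem_image,
    Fintype.mem_piFinset, IsSelection]
  constructor
  · rintro ⟨J, hJ, a, ha, rfl⟩
    exact ⟨J, a, ⟨hJ, fun j hj => by simpa [hj] using ha j⟩, rfl⟩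
  · rintro ⟨J, a, ⟨hJ, ha⟩, rfl⟩
    refine ⟨J, hJ, fun j => if j ∈ J then a j else 0, fun j => ?_, sum_congr rfl fun j hj => ?_⟩
    · by_cases hj : j ∈ J
      · simpa [hj] using ha j hj
      · simp [hj]
    · simp [hj]

theorem IsSelection.sum_mem (h : IsSelection ℓ A J a) : ∑ j ∈ J, a j ∈ selectionSums ℓ A :=
  mem_selectionSums.2 ⟨J, a, h, rfl⟩

theorem selectionSums_mono {B : ι → Finset Γ} (hAB : ∀ j, A j ⊆ B j) :
    selectionSums ℓ A ⊆ selectionSums ℓ B := by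
  intro x hx
  obtain ⟨J, a, h, rfl⟩ := mem_selectionSums.1 hx
  exact (h.mono hAB).sum_mem

theorem selectionSums_nonempty (h : ℓ ≤ #{i | (A i).Nonempty}) :
    (selectionSums ℓ A).Nonempty := by
  obtain ⟨J, hJ, hcard⟩ := exists_subset_card_eq h
  have hne : ∀ j ∈ J, (A j).Nonempty := fun j hj => (mem_filter.1 (hJ hj)).2
  classical
  exact ⟨_, IsSelection.sum_mem (J := J) (a := fun j => if h : (A j).Nonempty then h.choose else 0)
    ⟨hcard, fun j hj => by simpa [hne j hj] using (hne j hj).choose_spec⟩⟩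

theorem selectionSums_neg_subset : selectionSums ℓ (-A) ⊆ -selectionSums ℓ A := by
  intro x hx
  obtain ⟨J, a, h, rfl⟩ := mem_selectionSums.1 hx
  rw [Finset.mem_neg']
  refine mem_selectionSums.2 ⟨J, -a, ⟨h.1, fun j hj => ?_⟩, by simp⟩
  simpa [Finset.mem_neg'] using h.2 j hj

theorem card_selectionSums_neg : #(selectionSums ℓ (-A)) = #(selectionSums ℓ A) := by
  refine le_antisymm ?_ ?_
  · simpa using card_le_card (selectionSums_neg_subset (ℓ := ℓ) (A := A))
  · simpa using card_le_card (selectionSums_neg_subset (ℓ := ℓ) (A := -A))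

/-- The sum of the multiplicities of the elements of a sequence whose members are disjoint outside
`0`, the multiplicity of `0` being truncated at `ℓ`. -/
def weight (ℓ : ℕ) (A : ι → Finset Γ) : ℕ :=
  ∑ i, #((A i).erase 0) + min ℓ #{i | 0 ∈ A i}

theorem weight_neg : weight ℓ (-A) = weight ℓ A := by
  have h : ∀ i, ((-A) i).erase 0 = -((A i).erase 0) := fun i => by
    ext x; simp [Finset.mem_neg']
  simp only [weight, h, card_neg]
  simp

/-- The sequence obtained from `A` by removing `x` from its member `A i`. -/
def remove (A : ι → Finset Γ) (i : ι) (x : Γ) : ι → Finset Γ :=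
  Function.update A i ((A i).erase x)

theorem remove_self (i : ι) (x : Γ) : remove A i x i = (A i).erase x := by simp [remove]

theorem remove_of_ne {i j : ι} (h : j ≠ i) (x : Γ) : remove A i x j = A j := by
  simp [remove, Function.update_of_ne h]

theorem remove_subset (i : ι) (x : Γ) (j : ι) : remove A i x j ⊆ A j := by
  by_cases h : j = i
  · subst h; rw [remove_self]; exact erase_subset _ _
  · rw [remove_of_ne h]

theorem sum_card_remove {i : ι} {x : Γ} (hx : x ∈ A i) :
    ∑ j, #(remove A i x j) + 1 = ∑ j, #(A j) := by
  rw [← add_sum_erase univ (fun j => #(A j)) (mem_univ i),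
    ← add_sum_erase univ (fun j => #(remove A i x j)) (mem_univ i), remove_self,
    sum_congr rfl fun j hj => by rw [remove_of_ne (ne_of_mem_erase hj)], ← card_erase_add_one hx]
  ring

theorem weight_remove {i : ι} {x : Γ} (hx : x ∈ A i) (h0 : x ≠ 0) :
    weight ℓ (remove A i x) + 1 = weight ℓ A := by
  have h1 : ∀ j, (remove A i x j).erase 0 = remove (fun j => (A j).erase 0) i x j := by
    intro j
    by_cases h : j = i
    · subst h; rw [remove_self, remove_self, erase_right_comm]
    · rw [remove_of_ne h, remove_of_ne h]
  have h2 : ∀ j, (0 ∈ remove A i x j ↔ 0 ∈ A j) := by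
    intro j
    by_cases h : j = i
    · subst h; simp [remove_self, h0.symm]
    · rw [remove_of_ne h]
  simp only [weight, h1, h2]
  rw [← sum_card_remove (A := fun j => (A j).erase 0) (i := i) (x := x) (by simp [hx, h0])]
  ring

/-- Distinct members of `A` have no common element, except possibly `0`. -/
def DisjointOffZero (A : ι → Finset Γ) : Prop :=
  ∀ i j, i ≠ j → ∀ x ∈ A i, x ∈ A j → x = 0

theorem DisjointOffZero.mono {B : ι → Finset Γ} (h : DisjointOffZero B) (hAB : ∀ j, A j ⊆ B j) :
    DisjointOffZero A :=
  fun i j hij x hi hj => h i j hij x (hAB i hi) (hAB j hj)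

theorem DisjointOffZero.neg (h : DisjointOffZero A) : DisjointOffZero (-A) := by
  intro i j hij x hi hj
  simp only [Pi.neg_apply, Finset.mem_neg'] at hi hj
  simpa using h i j hij _ hi hj

/-- The indices of the members of `A` that have a nonzero element. -/
def nontrivialIndices (A : ι → Finset Γ) : Finset ι :=
  {i | ∃ x ∈ A i, x ≠ 0}

theorem mem_nontrivialIndices {i : ι} : i ∈ nontrivialIndices A ↔ ∃ x ∈ A i, x ≠ 0 := by
  simp [nontrivialIndices]

theorem nontrivialIndices_neg : nontrivialIndices (-A) = nontrivialIndices A := by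
  ext i
  simp only [mem_nontrivialIndices, Pi.neg_apply, Finset.mem_neg']
  exact ⟨fun ⟨x, hx, h0⟩ => ⟨-x, hx, by simpa⟩, fun ⟨x, hx, h0⟩ => ⟨-x, by simpa, by simpa⟩⟩

theorem erase_subset_nontrivialIndices_remove (i : ι) (x : Γ) :
    (nontrivialIndices A).erase i ⊆ nontrivialIndices (remove A i x) := by
  intro j hj
  rw [mem_erase, mem_nontrivialIndices] at hj
  rw [mem_nontrivialIndices, remove_of_ne hj.1]
  exact hj.2

theorem nontrivialIndices_subset_nonempty :
    nontrivialIndices A ⊆ ({i | (A i).Nonempty} : Finset ι) := by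
  intro j hj
  obtain ⟨x, hx, -⟩ := mem_nontrivialIndices.1 hj
  exact mem_filter.2 ⟨mem_univ _, x, hx⟩

end Basic

/-! ### The bound in a linearly ordered group. -/

section Order

variable {ι Γ : Type*} [AddCommGroup Γ] [LinearOrder Γ] [IsOrderedAddMonoid Γ] [Fintype ι]
  [DecidableEq ι] {ℓ : ℕ} {A B : ι → Finset Γ} {i : ι} {M : Γ}

/-- `M` is positive, lies in `A i`, and is the largest element of all members of `A`. -/
structure IsTop (A : ι → Finset Γ) (i : ι) (M : Γ) : Prop where
  mem : M ∈ A i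
  pos : 0 < M
  le : ∀ j, ∀ x ∈ A j, x ≤ M

theorem exists_isTop (h : ∃ i, ∃ x ∈ A i, 0 < x) : ∃ i M, IsTop A i M := by
  obtain ⟨i, x, hx, h0⟩ := h
  have hne : (univ.biUnion A).Nonempty := ⟨x, mem_biUnion.2 ⟨i, mem_univ _, hx⟩⟩
  obtain ⟨j, -, hj⟩ := mem_biUnion.1 (max'_mem _ hne)
  have hle : ∀ j, ∀ y ∈ A j, y ≤ (univ.biUnion A).max' hne := fun j y hy =>
    le_max' _ _ (mem_biUnion.2 ⟨j, mem_univ _, hy⟩)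
  exact ⟨j, _, hj, h0.trans_le (hle i x hx), hle⟩

/-- A second occurrence of M would be a repeated nonzero element. -/
theorem IsTop.lt (h : IsTop A i M) (hA : DisjointOffZero A) {j : ι} {x : Γ}
    (hx : x ∈ remove A i M j) : x < M := by
  refine lt_of_le_of_ne (h.le j x (remove_subset i M j hx)) ?_
  rintro rfl
  by_cases hj : j = i
  · subst hj; simp [remove_self] at hx
  · rw [remove_of_ne hj] at hx
    exact h.pos.ne' (hA j i hj _ hx h.mem)

theorem exists_max_selection (h : (selectionSums ℓ B).Nonempty) :
    ∃ J a, IsSelection ℓ B J a ∧ ∀ x ∈ selectionSums ℓ B, x ≤ ∑ j ∈ J, a j := by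
  obtain ⟨J, a, hJ, hs⟩ := mem_selectionSums.1 (max'_mem _ h)
  exact ⟨J, a, hJ, fun x hx => hs ▸ le_max' _ _ hx⟩

/-- Put M in place of `a i` if `i` is selected, and in place of any chosen element otherwise. -/
theorem IsTop.exists_lt (h : IsTop A i M) (hA : DisjointOffZero A) (hℓ : 1 ≤ ℓ) {J : Finset ι}
    {a : ι → Γ} (hs : IsSelection ℓ (remove A i M) J a) :
    ∃ y ∈ selectionSums ℓ A, ∑ j ∈ J, a j < y := by
  have hs' := hs.mono (remove_subset (A := A) i M)
  by_cases hi : i ∈ J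
  · obtain ⟨h1, h2⟩ := hs'.update hi h.mem
    refine ⟨_, h1.sum_mem, ?_⟩
    have := h.lt hA (hs.2 i hi)
    rw [h2, sub_add_eq_add_sub, lt_sub_iff_add_lt]
    gcongr
  · obtain ⟨j, hj⟩ := card_pos.1 (hℓ.trans_eq hs.1.symm)
    obtain ⟨h1, h2⟩ := hs'.exchange hi hj h.mem
    refine ⟨_, h1.sum_mem, ?_⟩
    have := h.lt hA (hs.2 j hj)
    rw [h2, sub_add_eq_add_sub, lt_sub_iff_add_lt]
    gcongr

theorem IsTop.card_add_one_le (h : IsTop A i M) (hA : DisjointOffZero A) (hℓ : 1 ≤ ℓ)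
    (hne : (selectionSums ℓ (remove A i M)).Nonempty) :
    #(selectionSums ℓ (remove A i M)) + 1 ≤ #(selectionSums ℓ A) := by
  obtain ⟨J, a, hs, hmax⟩ := exists_max_selection hne
  obtain ⟨y, hy, hlt⟩ := h.exists_lt hA hℓ hs
  rw [Nat.add_one_le_iff]
  refine card_lt_card ((ssubset_iff_of_subset (selectionSums_mono (remove_subset i M))).2
    ⟨y, hy, fun hy' => (hmax y hy').not_gt hlt⟩)

theorem card_add_two_le {s x y : Γ} (hBA : ∀ j, B j ⊆ A j) (hmax : ∀ x ∈ selectionSums ℓ B, x ≤ s)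
    (hx : x ∈ selectionSums ℓ A) (hy : y ∈ selectionSums ℓ A) (hsx : s < x) (hsy : s < y)
    (hxy : x ≠ y) : #(selectionSums ℓ B) + 2 ≤ #(selectionSums ℓ A) := by
  have hy' : y ∉ selectionSums ℓ B := fun h => (hmax y h).not_gt hsy
  have hx' : x ∉ insert y (selectionSums ℓ B) := fun h =>
    (mem_insert.1 h).elim hxy fun h => (hmax x h).not_gt hsx
  have h := card_le_card (insert_subset hx (insert_subset hy (selectionSums_mono (ℓ := ℓ) hBA)))
  rwa [card_insert_of_notMem hx', card_insert_of_notMem hy'] at h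

theorem exists_pos_or_neg (h : ∃ i, ∃ x ∈ A i, x ≠ 0) :
    (∃ i, ∃ x ∈ A i, 0 < x) ∨ ∃ i, ∃ x ∈ (-A) i, 0 < x := by
  obtain ⟨i, x, hx, h0⟩ := h
  rcases h0.lt_or_gt with h | h
  · exact .inr ⟨i, -x, by simpa using hx, by simpa using h⟩
  · exact .inl ⟨i, x, hx, h⟩

theorem sum_card_neg : ∑ i, #((-A) i) = ∑ i, #(A i) := by simp

theorem card_nonempty_neg : #{i | ((-A) i).Nonempty} = #{i | (A i).Nonempty} := by simp

/-- The rank-`ℓ` case of the DeVos–Goddyn–Mohar bound for a sequence whose members are disjoint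
outside `0` in a linearly ordered group. -/
theorem weight_add_one_le (ℓ : ℕ) (A : ι → Finset Γ) (hA : DisjointOffZero A)
    (hne : ℓ ≤ #{i | (A i).Nonempty}) (h0 : ℓ = 0 → ∀ i, A i = ∅) :
    weight ℓ A + 1 ≤ #(selectionSums ℓ A) + ℓ := by
  induction hn : ∑ i, #(A i) using Nat.strong_induction_on generalizing ℓ A with
  | _ n ih =>
  subst hn
  by_cases hz : ∃ i, ∃ x ∈ A i, x ≠ 0
  · wlog hpos : ∃ i, ∃ x ∈ A i, 0 < x generalizing A
    · have hneg := (exists_pos_or_neg hz).resolve_left hpos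
      obtain ⟨i, x, hx, hx0⟩ := hneg
      have := this (-A) hA.neg (by rwa [card_nonempty_neg])
        (fun h i => by simp [h0 h i]) (by rwa [sum_card_neg])
        ⟨i, x, hx, hx0.ne'⟩ ⟨i, x, hx, hx0⟩
      rwa [weight_neg, card_selectionSums_neg] at this
    obtain ⟨i, M, h⟩ := exists_isTop hpos
    have hℓ : 1 ≤ ℓ := by
      by_contra hℓ
      have := h.mem
      simp [h0 (by omega) i] at this
    have hA' := hA.mono (remove_subset i M)
    have hw := weight_remove (ℓ := ℓ) h.mem h.pos.ne'
    have hlt := sum_card_remove h.mem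
    by_cases hne' : ℓ ≤ #{j | (remove A i M j).Nonempty}
    · have h1 := ih _ (by omega) ℓ (remove A i M) hA' hne' (by omega) rfl
      have h2 := h.card_add_one_le hA hℓ (selectionSums_nonempty hne')
      omega
    -- Here `A i = {M}` and exactly `ℓ` members are nonempty, so M occurs in every sum: strip it and
    -- pass to rank `ℓ - 1`.
    · have hsub : ({j | (A j).Nonempty} : Finset ι).erase i ⊆
          ({j | (remove A i M j).Nonempty} : Finset ι) := by
        intro j hj
        simp only [mem_erase, mem_filter, mem_univ, true_and] at hj ⊢
        rw [remove_of_ne hj.1]; exact hj.2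
      have hi : i ∈ ({j | (A j).Nonempty} : Finset ι) := mem_filter.2 ⟨mem_univ _, M, h.mem⟩
      have hcard := card_le_card hsub
      rw [card_erase_of_mem hi] at hcard
      have hi' : ¬ (remove A i M i).Nonempty := by
        intro hi'
        have hss : ({j | (A j).Nonempty} : Finset ι) ⊆
            ({j | (remove A i M j).Nonempty} : Finset ι) := by
          intro j hj
          by_cases hji : j = i
          · subst hji; simpa using hi'
          · exact hsub (mem_erase.2 ⟨hji, hj⟩)
        have := card_le_card hss
        omega
      have h1 := ih _ (by omega) (ℓ - 1) (remove A i M) hA' (by omega) (fun hℓ0 j => by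
        have hc : #{j | (remove A i M j).Nonempty} = 0 := by omega
        rw [card_eq_zero, filter_eq_empty_iff] at hc
        exact not_nonempty_iff_eq_empty.1 (hc (mem_univ j))) rfl
      -- Truncation at `ℓ` and at `ℓ - 1` therefore give the same weight.
      have hk : #{j | 0 ∈ remove A i M j} ≤ ℓ - 1 := by
        refine le_trans (card_le_card ?_) (Nat.le_sub_one_of_lt (not_le.1 hne'))
        exact monotone_filter_right _ fun j _ hj => ⟨0, hj⟩
      have h2 : #(selectionSums (ℓ - 1) (remove A i M)) ≤ #(selectionSums ℓ A) := by
        refine card_le_card_of_injOn (fun x => M + x) (fun x hx => ?_)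
          (add_right_injective M).injOn
        obtain ⟨J, a, hs, rfl⟩ := mem_selectionSums.1 hx
        have hiJ : i ∉ J := fun hiJ => hi' ⟨_, hs.2 i hiJ⟩
        refine mem_selectionSums.2 ⟨insert i J, Function.update a i M, ⟨?_, ?_⟩, ?_⟩
        · rw [card_insert_of_notMem hiJ, hs.1]; omega
        · intro j hj
          by_cases hji : j = i
          · subst hji; simpa using h.mem
          · rw [Function.update_of_ne hji]
            exact remove_subset i M j (hs.2 j ((mem_insert.1 hj).resolve_left hji))
        · rw [sum_insert hiJ, sum_update_of_notMem hiJ, Function.update_self]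
      have hw' : weight ℓ (remove A i M) = weight (ℓ - 1) (remove A i M) := by
        simp only [weight]; omega
      omega
  · push Not at hz
    have h1 : ∀ i, (A i).erase 0 = ∅ := fun i => by
      ext x; simpa [imp_not_comm] using hz i x
    have h2 : weight ℓ A ≤ ℓ := by simp [weight, h1]
    have := card_pos.2 (selectionSums_nonempty hne)
    omega

/-! ### Strictness: the exceptional shapes and their exclusion. -/

/-- All members of `A` other than `A i` are nonpositive, and `ℓ` of them contain `0`. -/
def OthersNonpos (ℓ : ℕ) (A : ι → Finset Γ) (i : ι) : Prop :=
  (∀ j, j ≠ i → ∀ x ∈ A j, x ≤ 0) ∧ ∃ J : Finset ι, #J = ℓ ∧ ∀ j ∈ J, j ≠ i ∧ 0 ∈ A j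

/-- The configuration in which adjoining the largest element `M` to `A i` yields only one new sum,
although `A i` contributes `0` to every largest sum not involving `M`. -/
structure ZeroUsed (ℓ : ℕ) (A : ι → Finset Γ) (i : ι) (M : Γ) (J : Finset ι) : Prop where
  card_eq : #J = ℓ
  mem : i ∈ J
  zero_mem : 0 ∈ A i
  outside : ∀ j ∉ J, 0 ∉ A j ∧ ∀ x ∈ A j, x < 0
  nonpos : ∀ j, j ≠ i → 0 ∈ A j → ∀ x ∈ A j, x ≤ 0
  add_nonpos : ∀ j, j ≠ i → 0 ∈ A j → ∀ h ∉ J, ∀ b ∈ A h, M + b ≤ 0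

/-- Each `a j` can be exchanged for M. Two distinct values give two new sums above the old maximum;
a single common value lies in two members, so it is 0, and maximality makes the other members
nonpositive. -/
theorem IsTop.gain_two_of_notMem (h : IsTop A i M) (hA : DisjointOffZero A) (hℓ : 2 ≤ ℓ)
    {J : Finset ι} {a : ι → Γ} (hs : IsSelection ℓ (remove A i M) J a)
    (hmax : ∀ x ∈ selectionSums ℓ (remove A i M), x ≤ ∑ j ∈ J, a j) (hi : i ∉ J) :
    #(selectionSums ℓ (remove A i M)) + 2 ≤ #(selectionSums ℓ A) ∨ OthersNonpos ℓ A i := by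
  have hs' := hs.mono (remove_subset (A := A) i M)
  have hlt : ∀ j ∈ J, a j < M := fun j hj => h.lt hA (hs.2 j hj)
  by_cases hex : ∃ j ∈ J, ∃ k ∈ J, a j ≠ a k
  · left
    obtain ⟨j, hj, k, hk, hjk⟩ := hex
    obtain ⟨hj1, hj2⟩ := hs'.exchange hi hj h.mem
    obtain ⟨hk1, hk2⟩ := hs'.exchange hi hk h.mem
    have hj3 := hj1.sum_mem
    have hk3 := hk1.sum_mem
    rw [hj2] at hj3
    rw [hk2] at hk3
    refine card_add_two_le (remove_subset i M) hmax hj3 hk3 ?_ ?_ ?_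
    · have := hlt j hj
      rw [sub_add_eq_add_sub, lt_sub_iff_add_lt]; gcongr
    · have := hlt k hk
      rw [sub_add_eq_add_sub, lt_sub_iff_add_lt]; gcongr
    · simpa using hjk
  · right
    push Not at hex
    obtain ⟨j₀, hj₀, k₀, hk₀, hne⟩ := one_lt_card.1 (show 1 < #J by rw [hs.1]; omega)
    have ha : ∀ j ∈ J, a j = 0 := by
      intro j hj
      rw [hex j hj j₀ hj₀]
      exact hA j₀ k₀ hne _ (hs'.2 _ hj₀) (by rw [hex j₀ hj₀ k₀ hk₀]; exact hs'.2 _ hk₀)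
    refine ⟨fun j hji x hx => ?_, J, hs.1, fun j hj => ⟨?_, ?_⟩⟩
    · rw [← remove_of_ne (A := A) hji M] at hx
      by_cases hj : j ∈ J
      · obtain ⟨h1, h2⟩ := hs.update hj hx
        have := hmax _ h1.sum_mem
        rwa [h2, ha j hj, sub_zero, add_le_iff_nonpos_right] at this
      · obtain ⟨h1, h2⟩ := hs.exchange hj hj₀ hx
        have := hmax _ h1.sum_mem
        rwa [h2, ha j₀ hj₀, sub_zero, add_le_iff_nonpos_right] at this
    · rintro rfl; exact hi hj
    · rw [← ha j hj]; exact hs'.2 j hj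

/-- When every maximal selection without M uses `i`, the contribution of `A i` is 0. Unless two sums
are gained, s + M is the only sum above the old maximum s; this uniqueness yields `ZeroUsed`. -/
theorem IsTop.gain_two (h : IsTop A i M) (hA : DisjointOffZero A) (hℓ : 2 ≤ ℓ)
    (hM : ∀ x ∈ A i, x = 0 ∨ x = M) (hne : (selectionSums ℓ (remove A i M)).Nonempty) :
    #(selectionSums ℓ (remove A i M)) + 2 ≤ #(selectionSums ℓ A) ∨ OthersNonpos ℓ A i ∨
      ∃ J, ZeroUsed ℓ A i M J := by
  by_cases hout : ∃ J a, IsSelection ℓ (remove A i M) J a ∧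
      (∀ x ∈ selectionSums ℓ (remove A i M), x ≤ ∑ j ∈ J, a j) ∧ i ∉ J
  · obtain ⟨J, a, hs, hmax, hi⟩ := hout
    exact (h.gain_two_of_notMem hA hℓ hs hmax hi).imp_right .inl
  obtain ⟨J, a, hs, hmax⟩ := exists_max_selection hne
  have hi : i ∈ J := by
    by_contra hi
    exact hout ⟨J, a, hs, hmax, hi⟩
  have hs' := hs.mono (remove_subset (A := A) i M)
  have hai : a i = 0 := by
    refine (hM _ (hs'.2 i hi)).resolve_right fun hh => ?_
    exact (h.lt hA (hs.2 i hi)).ne hh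
  by_cases hgain : #(selectionSums ℓ (remove A i M)) + 2 ≤ #(selectionSums ℓ A)
  · exact .inl hgain
  obtain ⟨hM1, hM2⟩ := hs'.update hi h.mem
  rw [hai, sub_zero] at hM2
  have huniq : ∀ y ∈ selectionSums ℓ A, ∑ j ∈ J, a j < y → y = ∑ j ∈ J, a j + M := by
    intro y hy hlt
    by_contra hne
    exact hgain (card_add_two_le (remove_subset i M) hmax hy (hM2 ▸ hM1.sum_mem) hlt
      (by simpa using h.pos) hne)
  -- Such a 0 could replace that of `A i`, giving a maximal selection avoiding `i`.
  have hout0 : ∀ j ∉ J, 0 ∉ A j := by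
    intro j hj h0
    have hji : j ≠ i := by rintro rfl; exact hj hi
    rw [← remove_of_ne (A := A) hji M] at h0
    obtain ⟨h1, h2⟩ := hs.exchange hj hi h0
    rw [hai, sub_zero, add_zero] at h2
    refine hout ⟨_, _, h1, fun x hx => (hmax x hx).trans_eq h2.symm, fun hmem => ?_⟩
    rw [mem_insert] at hmem
    exact hmem.elim hji.symm (notMem_erase i J)
  -- Replacing `a j < M` by 0 in s + M leaves a sum above s, which by uniqueness is s + M itself.
  have hzero : ∀ j, j ≠ i → 0 ∈ A j → j ∈ J ∧ a j = 0 := by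
    intro j hji h0
    have hj : j ∈ J := by
      by_contra hj; exact hout0 j hj h0
    refine ⟨hj, ?_⟩
    have h0' : (0 : Γ) ∈ A j := h0
    obtain ⟨h1, h2⟩ := hM1.update hj h0'
    rw [hM2, add_zero, Function.update_of_ne hji] at h2
    have := huniq _ h1.sum_mem (by
      have := h.lt hA (hs.2 j hj)
      rw [h2, lt_sub_iff_add_lt]; gcongr)
    rw [h2] at this
    simpa using this
  refine .inr (.inr ⟨J, hs.1, hi, hai ▸ hs'.2 i hi, fun j hj => ⟨hout0 j hj, fun x hx => ?_⟩,
    fun j hji h0 x hx => ?_, fun j hji h0 k hk b hb => ?_⟩)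
  · have hji : j ≠ i := by rintro rfl; exact hj hi
    refine lt_of_le_of_ne ?_ (by rintro rfl; exact hout0 j hj hx)
    rw [← remove_of_ne (A := A) hji M] at hx
    obtain ⟨h1, h2⟩ := hs.exchange hj hi hx
    have := hmax _ h1.sum_mem
    rwa [h2, hai, sub_zero, add_le_iff_nonpos_right] at this
  · obtain ⟨hj, haj⟩ := hzero j hji h0
    rw [← remove_of_ne (A := A) hji M] at hx
    obtain ⟨h1, h2⟩ := hs.update hj hx
    have := hmax _ h1.sum_mem
    rwa [h2, haj, sub_zero, add_le_iff_nonpos_right] at this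
  · obtain ⟨hj, haj⟩ := hzero j hji h0
    -- Trading the 0 of `A j` for `b` gives s + M + b, a second new sum if M + b > 0, because `b ≠
    -- 0`.
    obtain ⟨h1, h2⟩ := hM1.exchange hk hj hb
    rw [hM2, Function.update_of_ne hji, haj, sub_zero, add_assoc] at h2
    by_contra hcon
    have := huniq _ h1.sum_mem (by rw [h2]; simpa using hcon)
    rw [h2, add_right_inj, add_eq_left] at this
    subst this
    exact hout0 k hk hb

/-- Of at least three nontrivial members, one is neither `A i` nor `A g`; its elements are both
nonpositive and nonnegative. -/
theorem OthersNonpos.not_neg {g : ι} (hℓ : 2 ≤ ℓ) (hP : ℓ + 1 ≤ #(nontrivialIndices A))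
    (h : OthersNonpos ℓ A i) (h' : OthersNonpos ℓ (-A) g) : False := by
  obtain ⟨j, hj⟩ : (((nontrivialIndices A).erase i).erase g).Nonempty := by
    rw [← card_pos]
    have := pred_card_le_card_erase (s := nontrivialIndices A) (a := i)
    have := pred_card_le_card_erase (s := (nontrivialIndices A).erase i) (a := g)
    omega
  rw [mem_erase, mem_erase, mem_nontrivialIndices] at hj
  obtain ⟨hg, hi, x, hx, hx0⟩ := hj
  have h2 := h'.1 j hg (-x) (by simpa using hx)
  exact hx0 (le_antisymm (h.1 j hi x hx) (by simpa using h2))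

/-- Members of `A` outside `J` are positive and those other than `A i` nonpositive, so counting
makes `J` exactly the nontrivial indices other than `i`. One of these, distinct from `g`, has a
member containing 0, which `nonpos` then forces to be `{0}`. -/
theorem OthersNonpos.not_zeroUsed_neg {g : ι} {n : Γ} {J : Finset ι} (hℓ : 2 ≤ ℓ)
    (hP : ℓ + 1 ≤ #(nontrivialIndices A))
    (h : OthersNonpos ℓ A i) (h' : ZeroUsed ℓ (-A) g n J) : False := by
  obtain ⟨hle, K, hK, hK0⟩ := h
  obtain ⟨j, hjK, hjg⟩ := exists_mem_ne (show 1 < #K by omega) g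
  obtain ⟨hji, hj0⟩ := hK0 j hjK
  have hsub : (nontrivialIndices A).erase i ⊆ J := by
    intro k hk
    rw [mem_erase, mem_nontrivialIndices] at hk
    obtain ⟨hki, x, hx, -⟩ := hk
    by_contra hkJ
    have := (h'.outside k hkJ).2 (-x) (by simpa using hx)
    exact (hle k hki x hx).not_gt (by simpa using this)
  have heq := eq_of_subset_of_card_le hsub (by
    have := pred_card_le_card_erase (s := nontrivialIndices A) (a := i)
    have := h'.card_eq
    omega)
  have hjJ : j ∈ J := by
    by_contra hjJ
    exact (h'.outside j hjJ).1 (by simpa using hj0)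
  rw [← heq, mem_erase, mem_nontrivialIndices] at hjJ
  obtain ⟨-, x, hx, hx0⟩ := hjJ
  have := h'.nonpos j hjg (by simpa using hj0) (-x) (by simpa using hx)
  exact hx0 (le_antisymm (hle j hji x hx) (by simpa using this))

theorem ZeroUsed.exists_outside {J : Finset ι} (hP : ℓ + 1 ≤ #(nontrivialIndices A))
    (h : ZeroUsed ℓ A i M J) : ∃ k ∉ J, ∃ b ∈ A k, b < 0 := by
  obtain ⟨k, hk, hkJ⟩ := exists_mem_notMem_of_card_lt_card
    (show #J < #(nontrivialIndices A) by rw [h.card_eq]; omega)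
  obtain ⟨b, hb, -⟩ := mem_nontrivialIndices.1 hk
  exact ⟨k, hkJ, b, hb, (h.outside k hkJ).2 b hb⟩

/-- A negative `b` outside `J` satisfies `M ≤ -b ≤ n`, and equality would put `-n` in two members.
Applied to `-A` as well, this gives the contradiction `n < M`. -/
theorem ZeroUsed.lt_of_neg {g : ι} {n : Γ} {J K : Finset ι} (hA : DisjointOffZero A)
    (hP : ℓ + 1 ≤ #(nontrivialIndices A)) (ht' : IsTop (-A) g n) (hig : i ≠ g)
    (h : ZeroUsed ℓ A i M J) (h' : ZeroUsed ℓ (-A) g n K) : M < n := by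
  obtain ⟨k, hk, b, hb, hb0⟩ := h.exists_outside hP
  have hg0 : 0 ∈ A g := by simpa using h'.zero_mem
  have h1 := h.add_nonpos g hig.symm hg0 k hk b hb
  have h2 := ht'.le k (-b) (by simpa using hb)
  refine lt_of_le_of_ne ((le_neg_iff_add_nonpos_right.2 h1).trans h2) fun hh => ?_
  have h3 : -b = n := le_antisymm h2 (hh ▸ le_neg_iff_add_nonpos_right.2 h1)
  have hkg : k ≠ g := by
    rintro rfl; exact (h.outside k hk).1 hg0
  exact hb0.ne (hA k g hkg b hb (by simpa [← h3] using ht'.mem))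

theorem weight_add_two_le_of_gain (h : IsTop A i M) (hA : DisjointOffZero A) (hℓ : 2 ≤ ℓ)
    (hP : ℓ + 1 ≤ #(nontrivialIndices A))
    (hg : #(selectionSums ℓ (remove A i M)) + 2 ≤ #(selectionSums ℓ A)) :
    weight ℓ A + 2 ≤ #(selectionSums ℓ A) + ℓ := by
  have h1 := card_le_card ((erase_subset_nontrivialIndices_remove (A := A) i M).trans
    nontrivialIndices_subset_nonempty)
  have h2 := pred_card_le_card_erase (s := nontrivialIndices A) (a := i)
  have := weight_add_one_le ℓ (remove A i M) (hA.mono (remove_subset i M)) (by omega) (by omega)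
  have := weight_remove (ℓ := ℓ) h.mem h.pos.ne'
  omega

/-- The strict bound holds, or it fails to follow by removing the largest element. -/
theorem weight_add_two_le_or (hA : DisjointOffZero A) (hℓ : 2 ≤ ℓ)
    (hP : ℓ + 1 ≤ #(nontrivialIndices A)) (hpos : ∃ i, ∃ x ∈ A i, 0 < x)
    (ih : ∀ B : ι → Finset Γ, ∑ i, #(B i) < ∑ i, #(A i) → DisjointOffZero B →
      ℓ + 1 ≤ #(nontrivialIndices B) → weight ℓ B + 2 ≤ #(selectionSums ℓ B) + ℓ) :
    weight ℓ A + 2 ≤ #(selectionSums ℓ A) + ℓ ∨ ∃ i M, IsTop A i M ∧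
      (∀ x ∈ A i, x = 0 ∨ x = M) ∧ (OthersNonpos ℓ A i ∨ ∃ J, ZeroUsed ℓ A i M J) := by
  obtain ⟨i, M, h⟩ := exists_isTop hpos
  have hsub := erase_subset_nontrivialIndices_remove (A := A) i M
  have hne : (selectionSums ℓ (remove A i M)).Nonempty := by
    have h1 := card_le_card (hsub.trans nontrivialIndices_subset_nonempty)
    have h2 := pred_card_le_card_erase (s := nontrivialIndices A) (a := i)
    exact selectionSums_nonempty (by omega)
  by_cases hM : ∀ x ∈ A i, x = 0 ∨ x = M
  · rcases h.gain_two hA hℓ hM hne with hg | hbad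
    · exact .inl (weight_add_two_le_of_gain h hA hℓ hP hg)
    · exact .inr ⟨i, M, h, hM, hbad⟩
  · left
    push Not at hM
    obtain ⟨x, hx, hx0, hxM⟩ := hM
    have hP' : nontrivialIndices A ⊆ nontrivialIndices (remove A i M) := by
      intro j hj
      by_cases hji : j = i
      · subst hji
        exact mem_nontrivialIndices.2 ⟨x, by simp [remove_self, hx, hxM], hx0⟩
      · exact hsub (mem_erase.2 ⟨hji, hj⟩)
    have h1 := sum_card_remove h.mem
    have h2 := ih (remove A i M) (by omega) (hA.mono (remove_subset i M))
      (hP.trans (card_le_card hP'))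
    have h3 := h.card_add_one_le hA (by omega) hne
    have := weight_remove (ℓ := ℓ) h.mem h.pos.ne'
    omega

theorem exists_neg_of_bad (hℓ : 2 ≤ ℓ) (hP : ℓ + 1 ≤ #(nontrivialIndices A))
    (h : OthersNonpos ℓ A i ∨ ∃ J, ZeroUsed ℓ A i M J) : ∃ j, ∃ x ∈ A j, x < 0 := by
  rcases h with h | ⟨J, h⟩
  · obtain ⟨j, hj, hji⟩ := exists_mem_ne (show 1 < #(nontrivialIndices A) by omega) i
    obtain ⟨x, hx, hx0⟩ := mem_nontrivialIndices.1 hj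
    exact ⟨j, x, hx, lt_of_le_of_ne (h.1 j hji x hx) hx0⟩
  · obtain ⟨k, -, b, hb, hb0⟩ := h.exists_outside hP
    exact ⟨k, b, hb, hb0⟩

/-- A sequence whose members are disjoint outside `0`, more than `ℓ ≥ 2` of which have a nonzero
element, never attains the bound `weight_add_one_le`. -/
theorem weight_add_two_le (hℓ : 2 ≤ ℓ) (A : ι → Finset Γ) (hA : DisjointOffZero A)
    (hP : ℓ + 1 ≤ #(nontrivialIndices A)) :
    weight ℓ A + 2 ≤ #(selectionSums ℓ A) + ℓ := by
  induction hn : ∑ i, #(A i) using Nat.strong_induction_on generalizing A with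
  | _ n ih =>
  subst hn
  have hz : ∃ i, ∃ x ∈ A i, x ≠ 0 := by
    obtain ⟨i, hi⟩ := card_pos.1 (show 0 < #(nontrivialIndices A) by omega)
    exact ⟨i, mem_nontrivialIndices.1 hi⟩
  wlog hpos : ∃ i, ∃ x ∈ A i, 0 < x generalizing A
  · obtain ⟨i, x, hx, hx0⟩ := (exists_pos_or_neg hz).resolve_left hpos
    have := this (-A) hA.neg (by rwa [nontrivialIndices_neg]) (by rwa [sum_card_neg])
      ⟨i, x, hx, hx0.ne'⟩ ⟨i, x, hx, hx0⟩
    rwa [weight_neg, card_selectionSums_neg] at this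
  have ih' : ∀ B : ι → Finset Γ, ∑ i, #(B i) < ∑ i, #(A i) → DisjointOffZero B →
      ℓ + 1 ≤ #(nontrivialIndices B) → weight ℓ B + 2 ≤ #(selectionSums ℓ B) + ℓ :=
    fun B hlt hB hPB => ih _ hlt B hB hPB rfl
  rcases weight_add_two_le_or hA hℓ hP hpos ih' with hw | ⟨i, M, ht, hM, hbad⟩
  · exact hw
  obtain ⟨j, x, hx, hx0⟩ := exists_neg_of_bad hℓ hP hbad
  have hP' : ℓ + 1 ≤ #(nontrivialIndices (-A)) := by rwa [nontrivialIndices_neg]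
  rcases weight_add_two_le_or hA.neg hℓ hP' ⟨j, -x, by simpa using hx, by simpa using hx0⟩
    (by rwa [sum_card_neg]) with hw | ⟨g, n, ht', hM', hbad'⟩
  · rwa [weight_neg, card_selectionSums_neg] at hw
  exfalso
  -- `A i ⊆ {0, M}` has no room for the negative element `-n`.
  have hig : i ≠ g := by
    rintro rfl
    rcases hM (-n) (by simpa using ht'.mem) with h | h
    · exact ht'.pos.ne' (by simpa using h)
    · exact (neg_neg_of_pos ht'.pos).not_gt (h ▸ ht.pos)
  rcases hbad with hbad | ⟨J, hbad⟩ <;> rcases hbad' with hbad' | ⟨K, hbad'⟩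
  · exact hbad.not_neg hℓ hP hbad'
  · exact hbad.not_zeroUsed_neg hℓ hP hbad'
  · exact hbad'.not_zeroUsed_neg hℓ hP' (by rwa [neg_neg])
  · exact (hbad.lt_of_neg hA hP ht' hig hbad').asymm
      (hbad'.lt_of_neg hA.neg hP' (by rwa [neg_neg]) hig.symm (by rwa [neg_neg]))

end Order

-- Embedding into an ordered group.

universe u

/-- A torsion-free commutative group embeds into a linearly ordered additive group. -/
theorem exists_embedding_ordered (G : Type u) [CommGroup G] [IsMulTorsionFree G] :
    ∃ (Γ : Type u) (_ : AddCommGroup Γ) (_ : LinearOrder Γ) (_ : IsOrderedAddMonoid Γ)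
      (f : Additive G →+ Γ), Function.Injective f := by
  let V := DivisibleHull (Additive G)
  let b := Module.Basis.ofVectorSpace ℚ V
  -- Any linear order on the basis serves: rational coordinates are then compared lexicographically.
  obtain ⟨o, -⟩ := exists_wellFoundedLT (Module.Basis.ofVectorSpaceIndex ℚ V)
  refine ⟨Lex (Module.Basis.ofVectorSpaceIndex ℚ V →₀ ℚ), inferInstance, inferInstance,
    inferInstance, ⟨⟨fun g => toLex (b.repr (g : V)), ?_⟩, ?_⟩, ?_⟩
  · have h : (((0 : Additive G)) : V) = 0 := DivisibleHull.mk_zero 1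
    rw [h, map_zero]; rfl
  · intro x y
    simp only [DivisibleHull.coe_add, map_add]; rfl
  · intro x y hxy
    exact DivisibleHull.coe_injective (b.repr.injective (toLex.injective hxy))

/-! ### Transfer from products to sums. -/

section Translate

variable {G Γ : Type*} [CommGroup G] [DecidableEq G] [AddCommGroup Γ] [DecidableEq Γ] {m : ℕ}

/-- The image of the sequence `A` under `f`, translated so that `e` becomes `0`. -/
def translate (f : Additive G →+ Γ) (e : G) (A : Fin m → Finset G) (i : Fin m) : Finset Γ :=
  (A i).image fun a => f (.ofMul a) - f (.ofMul e)

variable {f : Additive G →+ Γ} {e : G} {A : Fin m → Finset G}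

theorem translate_injective (hf : Function.Injective f) (e : G) :
    Function.Injective fun a : G => f (.ofMul a) - f (.ofMul e) :=
  fun _ _ h => Additive.ofMul.injective (hf (sub_left_injective h))

theorem mem_genProductSet {ℓ : ℕ} {x : G} :
    x ∈ genProductSet ℓ A ↔ ∃ J : Finset (Fin m), #J = ℓ ∧ ∃ a : Fin m → G,
      (∀ j ∈ J, a j ∈ A j) ∧ ∏ j ∈ J, a j = x := by
  constructor
  · rintro ⟨i, hi, a, ha, rfl⟩
    -- `Function.invFun` needs a nonempty domain.
    rcases isEmpty_or_nonempty (Fin ℓ) with hE | hE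
    · refine ⟨∅, ?_, fun _ => 1, by simp, ?_⟩
      · rw [card_empty, ← Fintype.card_fin ℓ, Fintype.card_eq_zero]
      · simp [List.prod_ofFn]
    · refine ⟨univ.image i, by simp [card_image_of_injective _ hi],
        fun j => a (Function.invFun i j), ?_, ?_⟩
      · intro j hj
        obtain ⟨k, -, rfl⟩ := mem_image.1 hj
        beta_reduce
        rw [Function.leftInverse_invFun hi k]; exact ha k
      · rw [prod_image hi.injOn, List.prod_ofFn]
        exact prod_congr rfl fun k _ => by rw [Function.leftInverse_invFun hi k]
  · rintro ⟨J, hJ, a, ha, rfl⟩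
    refine ⟨J.orderEmbOfFin hJ, (J.orderEmbOfFin hJ).injective, fun k => a (J.orderEmbOfFin hJ k),
      fun k => ha _ (orderEmbOfFin_mem J hJ k), ?_⟩
    rw [List.prod_ofFn]
    conv_lhs => rw [← J.image_orderEmbOfFin_univ hJ]
    rw [prod_image (J.orderEmbOfFin hJ).injective.injOn]

/-- Every sum is the image of a product x under x ↦ f(x) - ℓ f(e). -/
theorem card_selectionSums_translate_le (f : Additive G →+ Γ) (e : G) (ℓ : ℕ)
    (A : Fin m → Finset G) :
    #(selectionSums ℓ (translate f e A)) ≤ (genProductSet ℓ A).ncard := by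
  have hfin := genProductSet_finite ℓ A
  have hsub : (selectionSums ℓ (translate f e A) : Set Γ) ⊆
      (fun x : G => f (.ofMul x) - ℓ • f (.ofMul e)) '' genProductSet ℓ A := by
    intro y hy
    obtain ⟨J, b, hs, rfl⟩ := mem_selectionSums.1 (mem_coe.1 hy)
    have hb : ∀ j, ∃ a, j ∈ J → a ∈ A j ∧ f (.ofMul a) - f (.ofMul e) = b j := by
      intro j
      by_cases hj : j ∈ J
      · obtain ⟨a, ha, hab⟩ := mem_image.1 (hs.2 j hj)
        exact ⟨a, fun _ => ⟨ha, hab⟩⟩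
      · exact ⟨1, fun h => absurd h hj⟩
    choose a ha using hb
    refine ⟨∏ j ∈ J, a j, mem_genProductSet.2 ⟨J, hs.1, a, fun j hj => (ha j hj).1, rfl⟩, ?_⟩
    simp only [ofMul_prod, map_sum]
    rw [sum_congr rfl fun j hj => (ha j hj).2.symm, sum_sub_distrib, sum_const, hs.1]
  rw [← Set.ncard_coe_finset]
  exact (Set.ncard_le_ncard hsub (hfin.image _)).trans (Set.ncard_image_le hfin)

theorem zero_mem_translate (hf : Function.Injective f) {i : Fin m} :
    0 ∈ translate f e A i ↔ e ∈ A i := by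
  have := (translate_injective hf e).mem_finset_image (s := A i) (a := e)
  simpa [translate] using this

theorem sum_truncMult_le_weight (hf : Function.Injective f) (e : G) (ℓ : ℕ)
    (A : Fin m → Finset G) :
    ∑ a ∈ seqUnion A, truncMult ℓ A a ≤ weight ℓ (translate f e A) := by
  have h1 : ∀ i, #((translate f e A i).erase 0) = #((A i).erase e) := by
    intro i
    have : (translate f e A i).erase 0 =
        ((A i).erase e).image fun a => f (.ofMul a) - f (.ofMul e) := by
      rw [image_erase (translate_injective hf e), sub_self]; rfl
    rw [this, card_image_of_injective _ (translate_injective hf e)]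
  simp only [weight, h1, zero_mem_translate hf]
  -- `e` need not lie in the union; inserting it lets its term be split off, the only one whose
  -- truncation is kept.
  calc ∑ a ∈ seqUnion A, truncMult ℓ A a ≤ ∑ a ∈ insert e (seqUnion A), truncMult ℓ A a :=
        sum_le_sum_of_subset (subset_insert _ _)
    _ = ∑ a ∈ (seqUnion A).erase e, truncMult ℓ A a + truncMult ℓ A e := by
        rw [← erase_insert_eq_erase, sum_erase_add _ _ (mem_insert_self _ _)]
    _ ≤ ∑ a ∈ (seqUnion A).erase e, (∑ j, if a ∈ A j then 1 else 0) + truncMult ℓ A e := by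
        gcongr; exact min_le_right _ _
    _ ≤ _ := by
        gcongr ?_ + ?_
        · rw [sum_comm]
          refine sum_le_sum fun j _ => ?_
          rw [← card_filter]
          refine card_le_card fun a ha => ?_
          simp only [mem_filter, mem_erase] at ha ⊢
          exact ⟨ha.1.1, ha.2⟩
        · simp [truncMult]

theorem disjointOffZero_translate (hf : Function.Injective f)
    (h : ∀ i j, i ≠ j → ∀ a ∈ A i, a ∈ A j → a = e) : DisjointOffZero (translate f e A) := by
  intro i j hij x hi hj
  obtain ⟨a, ha, rfl⟩ := mem_image.1 hi
  rw [translate, (translate_injective hf e).mem_finset_image] at hj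
  rw [h i j hij a ha hj, sub_self]

theorem nontrivialIndices_translate (hf : Function.Injective f) (h : ∀ i, 2 ≤ #(A i)) :
    nontrivialIndices (translate f e A) = univ := by
  refine eq_univ_of_forall fun i => ?_
  obtain ⟨a, ha, hae⟩ := exists_mem_ne (show 1 < #(A i) from h i) e
  refine mem_nontrivialIndices.2 ⟨_, mem_image_of_mem _ ha, fun h0 => hae ?_⟩
  exact translate_injective hf e (by simpa using h0)

theorem two_le_truncMult {ℓ : ℕ} (hℓ : 2 ≤ ℓ) {i j : Fin m} (hij : i ≠ j) {a : G} (hi : a ∈ A i)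
    (hj : a ∈ A j) : 2 ≤ truncMult ℓ A a := by
  refine le_min hℓ ?_
  rw [← card_filter, ← card_pair hij]
  refine card_le_card (insert_subset ?_ (singleton_subset_iff.2 ?_)) <;> simpa

end Translate

end Transversal

open Transversal in
theorem theorem1p14 {G : Type*} [CommGroup G] [IsMulTorsionFree G] [DecidableEq G]
    (ℓ m : ℕ) (hℓ : 2 ≤ ℓ) (hm : ℓ < m) :
    ¬ ∃ A : Fin m → Finset G,
      (∀ i, 2 ≤ (A i).card) ∧
      ((seqUnion A).filter (fun a => 2 ≤ truncMult ℓ A a)).card ≤ 1 ∧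
      ((genProductSet ℓ A).ncard : ℤ) =
        (∑ a ∈ seqUnion A, (truncMult ℓ A a : ℤ)) - (ℓ : ℤ) + 1 := by
  rintro ⟨A, hA2, hrep, heq⟩
  obtain ⟨Γ, _, _, _, f, hf⟩ := exists_embedding_ordered G
  obtain ⟨e, he⟩ := Finset.card_le_one_iff_subset_singleton.1 hrep
  have hdisj : ∀ i j, i ≠ j → ∀ a ∈ A i, a ∈ A j → a = e := fun i j hij a hi hj =>
    Finset.mem_singleton.1 (he (Finset.mem_filter.2
      ⟨Finset.mem_biUnion.2 ⟨i, Finset.mem_univ _, hi⟩, two_le_truncMult hℓ hij hi hj⟩))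
  have h1 := weight_add_two_le hℓ (translate f e A) (disjointOffZero_translate hf hdisj)
    (by rw [nontrivialIndices_translate hf hA2]; simpa using hm)
  have h2 := sum_truncMult_le_weight hf e ℓ A
  have h3 := card_selectionSums_translate_le f e ℓ A
  rw [← Nat.cast_sum] at heq
  omega
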